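/- Let $n\in\mathbb{N}$ and let $K\subset\mathbb{R}^n$ be compact and path-connected. For a linear space $\mathcal V$ of real functions on $K$, a linear functional $L:\mathcal V\to\mathbb R$ is a $K$-moment functional if it has a representing measure, i.e. a (non-negative) Borel measure $\mu$ on $K$ such that every $v\in\mathcal V$ is $\mu$-integrable and $L(v)=\int_K v\,\mathrm d\mu$; likewise a linear functional $T:\mathbb R[t]\to\mathbb R$ is a $[0,1]$-moment functional (Hausdorff moment functional) if there is a representing Borel measure $\tilde\mu$ on $[0,1]$, i.e. $T(p)=\int_0^1 p\,\mathrm d\tilde\mu$ for all $p\in\mathbb R[t]$ (with $p$ $\tilde\mu$-integrable). For $g:K\to[0,1]$ put $\mathbb R[g]=\{p\circ g: p\in\mathbb R[t]\}$. A linear functional $\overline L:\mathcal V+\mathbb R[g]\to\mathbb R$ is called a continuous extension of $L$ if $\overline L|_{\mathcal V}=L$ and, whenever $p_i\in\mathbb R[t]$ converge uniformly on $[0,1]$ to some $p\in C([0,1],\mathbb R)$ with $p\circ g\in\mathcal V$, then $\overline L(p_i\circ g)\to L(p\circ g)$. For such $\overline L$ let $\tilde L:\mathbb R[t]\to\mathbb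 R$ be the linear functional with $\tilde L(t^d)=\overline L(g^d)$ for all $d\in\mathbb N_0$. Then there exists a Borel measurable function $g:K\to[0,1]$ with the following properties. (a) For every linear space $\mathcal V$ with $1\in\mathcal V\subseteq C(K,\mathbb R)$ and every linear functional $L:\mathcal V\to\mathbb R$ the following are equivalent: (i) $L$ is a $K$-moment functional; (ii) $L$ has a continuous extension $\overline L:\mathcal V+\mathbb R[g]\to\mathbb R$ such that $\tilde L$ is a $[0,1]$-moment functional. Moreover, for every representing measure $\mu$ of $L$ there is a continuous extension $\overline L$ of $L$ for which $\mu\circ g^{-1}$ is a representing measure of $\tilde L$. (b) If, in addition, $K$ is locally connected, then there is a continuous surjective function $f:[0,1]\to K$ (independent of $\mathcal V$, $L$, $\overline L$ and $\tilde L$) such that $f(g(x))=x$ for all $x\in K$ and such that, for all $\mathcal V$ and $L$ as in (a) and every continuous extension $\overline L$ of $L$, if $\tilde\mu$ is a representing measure of $\tilde L$, then $\tilde\mu\circ f^{-1}$ is a representing measure of $L$. -/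

import Mathlib

open MeasureTheory Filter Topology
open scoped Polynomial unitInterval

noncomputable section

namespace MomentTransform

/-- `μ` is a representing measure of the linear functional `L` on the space `V` of real functions
on `X`: every `v ∈ V` is `μ`-integrable and `L v = ∫ v dμ`. -/
def Represents {X : Type*} [MeasurableSpace X] {V : Submodule ℝ (X → ℝ)}
    (μ : Measure X) (L : V →ₗ[ℝ] ℝ) : Prop :=
  ∀ v : V, Integrable (v : X → ℝ) μ ∧ L v = ∫ x, (v : X → ℝ) x ∂μ

/-- `L` is a moment functional: it is represented by some (non-negative) measure on `X`. -/
def IsMomentFunctional {X : Type*} [MeasurableSpace X] {V : Submodule ℝ (X → ℝ)}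
    (L : V →ₗ[ℝ] ℝ) : Prop :=
  ∃ μ : Measure X, Represents μ L

/-- `μ` is a representing measure on `[0,1]` of the linear functional `T` on `ℝ[t]`. -/
def HausdorffRepresents (μ : Measure I) (T : ℝ[X] →ₗ[ℝ] ℝ) : Prop :=
  ∀ p : ℝ[X], Integrable (fun t : I => p.eval (t : ℝ)) μ ∧ T p = ∫ t : I, p.eval (t : ℝ) ∂μ

/-- `T` is a `[0,1]`-moment functional (Hausdorff moment functional) on `ℝ[t]`. -/
def IsHausdorffMomentFunctional (T : ℝ[X] →ₗ[ℝ] ℝ) : Prop :=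
  ∃ μ : Measure I, HausdorffRepresents μ T

/-- The linear map `p ↦ p ∘ g` from `ℝ[t]` to real functions on `X`, for `g : X → [0,1]`. -/
def polyComp {X : Type*} (g : X → I) : ℝ[X] →ₗ[ℝ] (X → ℝ) where
  toFun p := fun x => p.eval (g x : ℝ)
  map_add' p q := by ext x; simp
  map_smul' c p := by ext x; simp

/-- The space `ℝ[g]` of all polynomials in `g`. -/
def polySpace {X : Type*} (g : X → I) : Submodule ℝ (X → ℝ) :=
  LinearMap.range (polyComp g)

/-- The linear map `p ↦ p ∘ g` with values in `V + ℝ[g]`. -/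
def polyCompSup {X : Type*} (V : Submodule ℝ (X → ℝ)) (g : X → I) :
    ℝ[X] →ₗ[ℝ] ↥(V ⊔ polySpace g) :=
  (polyComp g).codRestrict (V ⊔ polySpace g) fun p =>
    Submodule.mem_sup_right (LinearMap.mem_range_self (polyComp g) p)

/-- The linear functional on `ℝ[t]` with `t ^ d ↦ Lbar (g ^ d)`, that is `p ↦ Lbar (p ∘ g)`. -/
def pullback {X : Type*} {V : Submodule ℝ (X → ℝ)} {g : X → I}
    (Lbar : ↥(V ⊔ polySpace g) →ₗ[ℝ] ℝ) : ℝ[X] →ₗ[ℝ] ℝ :=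
  Lbar ∘ₗ polyCompSup V g

/-- `Lbar : V + ℝ[g] → ℝ` continuously extends `L : V → ℝ`: it agrees with `L` on `V`, and
`Lbar (pᵢ ∘ g) → L (p ∘ g)` whenever the polynomials `pᵢ` converge uniformly on `[0,1]` to a
continuous `p` with `p ∘ g ∈ V`. -/
structure IsContinuousExtension {X : Type*} {V : Submodule ℝ (X → ℝ)} (g : X → I)
    (L : V →ₗ[ℝ] ℝ) (Lbar : ↥(V ⊔ polySpace g) →ₗ[ℝ] ℝ) : Prop where
  extends_eq : ∀ v : V, Lbar (Submodule.inclusion le_sup_left v) = L v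
  tendsto : ∀ (p : ℕ → ℝ[X]) (q : C(I, ℝ)) (hq : (fun x => q (g x)) ∈ V),
    TendstoUniformly (fun i (t : I) => (p i).eval (t : ℝ)) (fun t => q t) atTop →
      Tendsto (fun i => Lbar (polyCompSup V g (p i))) atTop (𝓝 (L ⟨fun x => q (g x), hq⟩))

end MomentTransform

end

/-!
A compact metrizable space `X` is the image of a closed set `C ⊆ [0,1]` under a map `f` continuous
on `C`: the Cantor set always works, and if `X` is connected and locally connected, then `C` can be
all of `[0,1]` (Hahn–Mazurkiewicz). For the latter, `f` is a uniform limit of step functions that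
run through finer and finer chains in `X`, each obtained from the previous one by inserting, between
two consecutive points, a chain inside a small connected set containing both.

Let `g x` be the least point of `C` over `x`. Then `g` is Borel, because `g⁻¹ [0,a]` is the compact
set `f (C ∩ [0,a])`, and `f ∘ g = id`. If `μ` represents `L`, then integration against `μ` is a
continuous extension. Conversely, if `μt` represents `pullback Lbar`, then, by Weierstrass,
`L (q ∘ g) = ∫ q dμt` for all continuous `q` with `q ∘ g ∈ V`. Taking for `q` a function that
vanishes exactly on `C` shows that `μt` lives on `C`; taking for `q` a Tietze extension of `v ∘ f`
from `C` gives `L v = ∫ v ∘ f dμt`.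
-/

namespace MomentTransform

section Walks

theorem exists_walk_forall_mem_support {W : Type*} {G : SimpleGraph W} (hG : G.Preconnected)
    {F : Set W} (hF : F.Finite) (u v : W) : ∃ p : G.Walk u v, ∀ z ∈ F, z ∈ p.support := by
  induction F, hF using Set.Finite.induction_on generalizing u with
  | empty => exact ⟨(hG u v).some, by simp⟩
  | @insert a s _ _ ih =>
    obtain ⟨p, hp⟩ := ih a
    refine ⟨(hG u a).some.append p, ?_⟩
    rintro z (rfl | hz)
    · exact (SimpleGraph.Walk.mem_support_append_iff _ _).2 (.inr p.start_mem_support)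
    · exact (SimpleGraph.Walk.mem_support_append_iff _ _).2 (.inr (hp z hz))

variable {X : Type*} [PseudoMetricSpace X] {η : ℝ}

/-- The graph on a metric space whose edges join distinct points at distance less than `η`; its
walks are the `η`-chains. -/
def proximityGraph (X : Type*) [PseudoMetricSpace X] (η : ℝ) : SimpleGraph X :=
  SimpleGraph.fromRel fun x y => dist x y < η

theorem proximityGraph_adj {x y : X} : (proximityGraph X η).Adj x y ↔ x ≠ y ∧ dist x y < η := by
  simp [proximityGraph, dist_comm y x]

theorem proximityGraph_reachable_of_dist_lt {x y : X} (h : dist x y < η) :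
    (proximityGraph X η).Reachable x y := by
  rcases eq_or_ne x y with rfl | hxy
  · rfl
  · exact (proximityGraph_adj.2 ⟨hxy, h⟩).reachable

theorem proximityGraph_preconnected [PreconnectedSpace X] (hη : 0 < η) :
    (proximityGraph X η).Preconnected := by
  refine PreconnectedSpace.induction₂' (proximityGraph X η).Reachable (fun x => ?_)
    ⟨fun _ _ _ => .trans⟩
  filter_upwards [Metric.ball_mem_nhds x hη] with y hy
  have hyx := proximityGraph_reachable_of_dist_lt hy
  exact ⟨hyx.symm, hyx⟩

theorem dist_getVert_succ_lt (hη : 0 < η) {x y : X} (p : (proximityGraph X η).Walk x y) (j : ℕ) :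
    dist (p.getVert j) (p.getVert (j + 1)) < η := by
  rcases lt_or_ge j p.length with hj | hj
  · exact (proximityGraph_adj.1 (p.adj_getVert_succ hj)).2
  · rwa [p.getVert_of_length_le hj, p.getVert_of_length_le (hj.trans j.le_succ), dist_self]

end Walks

section Tours

variable {X : Type*} {η : ℝ} {N : ℕ} {c : ℕ → X}

/-- The sequence that runs through `b 0 0, …, b 0 (M - 1)`, then `b 1 0, …, b 1 (M - 1)`, etc. -/
def concatBlocks (M : ℕ) (b : ℕ → ℕ → X) (j : ℕ) : X :=
  b (j / M) (j % M)

theorem concatBlocks_mul_add {M : ℕ} (b : ℕ → ℕ → X) (i : ℕ) {r : ℕ} (hr : r < M) :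
    concatBlocks M b (M * i + r) = b i r := by
  rw [concatBlocks, Nat.mul_add_div (by omega), Nat.div_eq_of_lt hr, add_zero,
    Nat.mul_add_mod, Nat.mod_eq_of_lt hr]

/-- The step function on `[0,1]` that takes the value `c i` on `[i / N, (i + 1) / N)`. -/
noncomputable def chainMap (N : ℕ) (c : ℕ → X) (t : I) : X :=
  c ⌊(t : ℝ) * N⌋₊

theorem exists_chainMap_eq (c : ℕ → X) {i : ℕ} (hi : i < N) : ∃ t, chainMap N c t = c i := by
  have hN : (N : ℝ) ≠ 0 := Nat.cast_ne_zero.2 (Nat.ne_zero_of_lt hi)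
  refine ⟨⟨i / N, unitInterval.div_mem i.cast_nonneg N.cast_nonneg (Nat.cast_le.2 hi.le)⟩, ?_⟩
  simp only [chainMap, div_mul_cancel₀ _ hN, Nat.floor_natCast]

theorem chainMap_concatBlocks {M : ℕ} (hM : M ≠ 0) (b : ℕ → ℕ → X) (t : I) :
    ∃ r, chainMap (N * M) (concatBlocks M b) t = b ⌊(t : ℝ) * N⌋₊ r := by
  rw [chainMap, concatBlocks, Nat.cast_mul, ← mul_assoc, Nat.mul_cast_floor_div_cancel hM]
  exact ⟨_, rfl⟩

variable [PseudoMetricSpace X]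

/-- An `η`-chain `c 0, …, c N` in `A` that comes `η`-close to every point of `A`. -/
structure IsTour (A : Set X) (η : ℝ) (N : ℕ) (c : ℕ → X) : Prop where
  mem : ∀ i, c i ∈ A
  dist_succ_lt : ∀ i < N, dist (c i) (c (i + 1)) < η
  exists_dist_lt : ∀ x ∈ A, ∃ i < N, dist x (c i) < η

theorem eventually_exists_isTour {A : Set X} (hA : IsPreconnected A) (hA' : TotallyBounded A)
    (hη : 0 < η) {x y : X} (hx : x ∈ A) (hy : y ∈ A) :
    ∀ᶠ N in atTop, ∃ c, IsTour A η N c ∧ c 0 = x ∧ c N = y := by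
  have : PreconnectedSpace A := Subtype.preconnectedSpace hA
  obtain ⟨F, hFA, hF, hcover⟩ := Metric.finite_approx_of_totallyBounded hA' η hη
  obtain ⟨p, hp⟩ := exists_walk_forall_mem_support (proximityGraph_preconnected (X := A) hη)
    (hF.preimage Subtype.val_injective.injOn) ⟨x, hx⟩ ⟨y, hy⟩
  filter_upwards [eventually_gt_atTop p.length] with N hN
  refine ⟨fun j => p.getVert j, ⟨fun j => (p.getVert j).2,
    fun j _ => dist_getVert_succ_lt hη p j, fun z hz => ?_⟩, by simp,
    by simp [p.getVert_of_length_le hN.le]⟩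
  obtain ⟨w, hw, hzw⟩ := Set.mem_iUnion₂.1 (hcover hz)
  obtain ⟨j, hj, hjp⟩ := SimpleGraph.Walk.mem_support_iff_exists_getVert.1 (hp ⟨w, hFA hw⟩ hw)
  exact ⟨j, hjp.trans_lt hN, by rwa [hj]⟩

theorem dist_concatBlocks_succ_lt {M : ℕ} {b : ℕ → ℕ → X}
    (hstep : ∀ i < N, ∀ r < M, dist (b i r) (b i (r + 1)) < η)
    (hjoin : ∀ i < N, b i M = b (i + 1) 0) {j : ℕ} (hj : j < N * M) :
    dist (concatBlocks M b j) (concatBlocks M b (j + 1)) < η := by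
  have hi : j / M < N := Nat.div_lt_of_lt_mul (by rwa [mul_comm])
  have hr : j % M < M := Nat.mod_lt _ (Nat.pos_of_ne_zero (by rintro rfl; simp at hj))
  have hsucc : concatBlocks M b (j + 1) = b (j / M) (j % M + 1) := by
    rw [← Nat.div_add_mod j M, add_assoc, Nat.div_add_mod]
    rcases Nat.lt_or_eq_of_le (Nat.succ_le_of_lt hr) with hlt | heq
    · exact concatBlocks_mul_add b _ hlt
    · rw [Nat.succ_eq_add_one] at heq
      rw [heq, hjoin _ hi, ← concatBlocks_mul_add b (j / M + 1) (Nat.zero_lt_of_lt hr)]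
      ring_nf
  rw [hsucc]
  exact hstep _ hi _ hr

theorem IsTour.dist_chainMap_lt {A : Set X} (h : IsTour A η N c) {s t : I}
    (hst : dist s t < 1 / N) : dist (chainMap N c s) (chainMap N c t) < η := by
  wlog hle : s ≤ t generalizing s t
  · rw [dist_comm]
    exact this (by rwa [dist_comm]) (le_of_not_ge hle)
  have hle' : (s : ℝ) ≤ t := hle
  have hNpos : 0 < N := (h.exists_dist_lt _ (h.mem 0)).elim fun i hi => Nat.zero_lt_of_lt hi.1
  have hN : (0 : ℝ) < N := Nat.cast_pos.2 hNpos
  have hmono : ⌊(s : ℝ) * N⌋₊ ≤ ⌊(t : ℝ) * N⌋₊ := Nat.floor_mono (by gcongr)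
  have hsucc : ⌊(t : ℝ) * N⌋₊ ≤ ⌊(s : ℝ) * N⌋₊ + 1 := by
    rw [← Nat.floor_add_one (mul_nonneg s.2.1 hN.le)]
    apply Nat.floor_mono
    rw [Subtype.dist_eq, dist_comm, Real.dist_eq, lt_div_iff₀ hN] at hst
    nlinarith [le_abs_self ((t : ℝ) - s)]
  have htN : ⌊(t : ℝ) * N⌋₊ ≤ N := Nat.floor_le_of_le (mul_le_of_le_one_left hN.le t.2.2)
  rw [chainMap, chainMap]
  rcases hmono.eq_or_lt with heq | hlt
  · rw [heq, dist_self]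
    exact dist_nonneg.trans_lt (h.dist_succ_lt 0 hNpos)
  · rw [show ⌊(t : ℝ) * N⌋₊ = ⌊(s : ℝ) * N⌋₊ + 1 by omega]
    exact h.dist_succ_lt _ (by omega)

end Tours

section ApproximateSurjections

variable {T X : Type*} [PseudoMetricSpace X]

/-- A map with oscillation less than `ε` at every point whose range is `ε`-dense; neither
continuity nor surjectivity is required. -/
structure IsApproxSurjection [TopologicalSpace T] (ε : ℝ) (F : T → X) : Prop where
  eventually_dist_lt : ∀ t, ∀ᶠ s in 𝓝 t, dist (F s) (F t) < ε
  exists_dist_lt : ∀ x, ∃ t, dist x (F t) < ε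

theorem IsApproxSurjection.mono [TopologicalSpace T] {ε ε' : ℝ} {F : T → X}
    (hF : IsApproxSurjection ε F) (hε : ε ≤ ε') : IsApproxSurjection ε' F where
  eventually_dist_lt t := (hF.eventually_dist_lt t).mono fun _ hs => hs.trans_le hε
  exists_dist_lt x := (hF.exists_dist_lt x).imp fun _ ht => ht.trans_le hε

variable {F : ℕ → T → X} {f : T → X}

theorem exists_tendstoUniformly_of_dist_le_geometric_two [CompleteSpace X] {C : ℝ}
    (hF : ∀ k t, dist (F k t) (F (k + 1) t) ≤ C / 2 / 2 ^ k) : ∃ f, TendstoUniformly F f atTop := by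
  choose f hf using fun t => cauchySeq_tendsto_of_complete
    (cauchySeq_of_le_geometric_two fun k => hF k t)
  have hlim : Tendsto (fun k : ℕ => C / 2 ^ k) atTop (𝓝 0) :=
    tendsto_const_nhds.div_atTop (tendsto_pow_atTop_atTop_of_one_lt one_lt_two)
  refine ⟨f, Metric.tendstoUniformly_iff.2 fun ε hε => ?_⟩
  filter_upwards [hlim.eventually_lt_const hε] with k hk t
  rw [dist_comm]
  exact (dist_le_of_le_geometric_two_of_tendsto (fun k => hF k t) (hf t) k).trans_lt hk

variable [TopologicalSpace T]

theorem continuous_of_tendstoUniformly_isApproxSurjection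
    (hF : TendstoUniformly F f atTop) (happ : ∀ ε > 0, ∀ᶠ k in atTop, IsApproxSurjection ε (F k)) :
    Continuous f := by
  refine continuous_iff_continuousAt.2 fun t => Metric.tendsto_nhds.2 fun ε hε => ?_
  have hε3 : 0 < ε / 3 := by positivity
  obtain ⟨k, hk, hunif⟩ := ((happ _ hε3).and (Metric.tendstoUniformly_iff.1 hF _ hε3)).exists
  filter_upwards [hk.eventually_dist_lt t] with s hs
  calc dist (f s) (f t) ≤ dist (f s) (F k s) + dist (F k s) (F k t) + dist (F k t) (f t) :=
        dist_triangle4 _ _ _ _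
    _ < ε / 3 + ε / 3 + ε / 3 := by
        rw [dist_comm (F k t)]
        gcongr
        exacts [hunif s, hunif t]
    _ = ε := add_thirds ε

theorem denseRange_of_tendstoUniformly_isApproxSurjection
    (hF : TendstoUniformly F f atTop) (happ : ∀ ε > 0, ∀ᶠ k in atTop, IsApproxSurjection ε (F k)) :
    DenseRange f := by
  refine fun x => Metric.mem_closure_range_iff.2 fun ε hε => ?_
  obtain ⟨k, hk, hunif⟩ :=
    ((happ _ (half_pos hε)).and (Metric.tendstoUniformly_iff.1 hF _ (half_pos hε))).exists
  obtain ⟨t, ht⟩ := hk.exists_dist_lt x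
  refine ⟨t, (dist_triangle x (F k t) (f t)).trans_lt ?_⟩
  rw [dist_comm (F k t)]
  linarith [hunif t]

end ApproximateSurjections

section HahnMazurkiewicz

variable {X : Type*} [PseudoMetricSpace X] {δ ε η : ℝ} {N : ℕ} {c : ℕ → X}

/-- Every ball of radius `δ` lies in a connected subset of the concentric ball of radius `ε`. -/
def IsConnectednessModulus (X : Type*) [PseudoMetricSpace X] (ε δ : ℝ) : Prop :=
  ∀ x : X, ∃ A : Set X, IsPreconnected A ∧ Metric.ball x δ ⊆ A ∧ A ⊆ Metric.ball x ε

theorem exists_isConnectednessModulus [CompactSpace X] [LocallyConnectedSpace X] (hε : 0 < ε) :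
    ∃ δ, 0 < δ ∧ δ ≤ ε ∧ IsConnectednessModulus X ε δ := by
  have hbasis (p : X) : ∃ U ⊆ Metric.ball p (ε / 2), IsOpen U ∧ p ∈ U ∧ IsConnected U :=
    locallyConnectedSpace_iff_subsets_isOpen_isConnected.1 inferInstance p _
      (Metric.ball_mem_nhds p (half_pos hε))
  choose U hUball hUopen hpU hUconn using hbasis
  obtain ⟨δ, hδ, hU⟩ := lebesgue_number_lemma_of_metric (isCompact_univ (X := X)) hUopen
    (fun p _ => Set.mem_iUnion.2 ⟨p, hpU p⟩)
  refine ⟨min δ ε, lt_min hδ hε, min_le_right _ _, fun x => ?_⟩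
  obtain ⟨p, hp⟩ := hU x trivial
  refine ⟨U p, (hUconn p).isPreconnected,
    (Metric.ball_subset_ball (min_le_left _ _)).trans hp, (hUball p).trans ?_⟩
  have hxp : dist x p < ε / 2 := hUball p (hp (Metric.mem_ball_self hδ))
  exact Metric.ball_subset_ball' (by linarith [dist_comm x p])

theorem IsTour.isApproxSurjection_chainMap (h : IsTour Set.univ η N c) :
    IsApproxSurjection η (chainMap N c) where
  eventually_dist_lt t := by
    obtain ⟨i, hi, -⟩ := h.exists_dist_lt (c 0) trivial
    have hN : (0 : ℝ) < 1 / N := Nat.one_div_cast_pos (Nat.ne_zero_of_lt hi)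
    filter_upwards [Metric.ball_mem_nhds t hN] with s hs
    exact h.dist_chainMap_lt hs
  exists_dist_lt x := by
    obtain ⟨i, hi, hx⟩ := h.exists_dist_lt x trivial
    obtain ⟨t, ht⟩ := exists_chainMap_eq c hi
    exact ⟨t, ht ▸ hx⟩

theorem IsTour.exists_blocks [CompactSpace X] (hδε : IsConnectednessModulus X ε δ) (hη : 0 < η)
    (h : IsTour Set.univ δ N c) :
    ∃ M ≠ 0, ∃ b : ℕ → ℕ → X, (∀ i, b i 0 = c i) ∧ (∀ i r, b i r ∈ Metric.ball (c i) ε) ∧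
      ∀ i < N, b i M = c (i + 1) ∧ ∃ A, Metric.ball (c i) δ ⊆ A ∧ IsTour A η M (b i) := by
  obtain ⟨_, _, hδ⟩ := h.exists_dist_lt (c 0) trivial
  choose A hA hδA hAε using fun i => hδε (c i)
  have hcA (i : ℕ) : c i ∈ A i := hδA i (Metric.mem_ball_self (dist_nonneg.trans_lt hδ))
  have hcA' (i : ℕ) (hi : i < N) : c (i + 1) ∈ A i :=
    hδA i (by simpa only [Metric.mem_ball'] using h.dist_succ_lt i hi)
  -- Tours can be prolonged, so one length `M` serves all blocks; this keeps the steps of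
  -- `chainMap` for the refined tour aligned with those for the coarse one.
  have htours : ∀ᶠ M in atTop, ∀ i ∈ Finset.range N,
      ∃ b, IsTour (A i) η M b ∧ b 0 = c i ∧ b M = c (i + 1) :=
    (Finset.range N).eventually_all.2 fun i hi => eventually_exists_isTour (hA i)
      (isCompact_univ.totallyBounded.subset (Set.subset_univ _)) hη (hcA i)
      (hcA' i (Finset.mem_range.1 hi))
  obtain ⟨M, hM, hM0⟩ := (htours.and (eventually_ne_atTop 0)).exists
  have hblock (i : ℕ) : ∃ b : ℕ → X, b 0 = c i ∧ (∀ r, b r ∈ Metric.ball (c i) ε) ∧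
      (i < N → b M = c (i + 1) ∧ ∃ A, Metric.ball (c i) δ ⊆ A ∧ IsTour A η M b) := by
    by_cases hi : i < N
    · obtain ⟨b, hb, hb0, hbM⟩ := hM i (Finset.mem_range.2 hi)
      exact ⟨b, hb0, fun r => hAε i (hb.mem r), fun _ => ⟨hbM, A i, hδA i, hb⟩⟩
    · exact ⟨fun _ => c i, rfl, fun _ => hAε i (hcA i), fun h => absurd h hi⟩
  choose b hb0 hbε hb using hblock
  exact ⟨M, hM0, b, hb0, hbε, hb⟩

theorem IsTour.exists_refinement [CompactSpace X] (hδε : IsConnectednessModulus X ε δ)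
    (hη : 0 < η) (h : IsTour Set.univ δ N c) :
    ∃ N' c', IsTour Set.univ η N' c' ∧ ∀ t, dist (chainMap N c t) (chainMap N' c' t) < ε := by
  obtain ⟨M, hM, b, hb0, hbε, hb⟩ := h.exists_blocks hδε hη
  choose hbM A hA htour using hb
  refine ⟨N * M, concatBlocks M b, ⟨fun _ => trivial, fun j => dist_concatBlocks_succ_lt
    (fun i hi => (htour i hi).dist_succ_lt) (fun i hi => (hbM i hi).trans (hb0 _).symm),
    fun z _ => ?_⟩, fun t => ?_⟩
  · obtain ⟨i, hi, hz⟩ := h.exists_dist_lt z trivial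
    obtain ⟨r, hr, hzr⟩ := (htour i hi).exists_dist_lt z (hA i hi hz)
    refine ⟨M * i + r, ?_, by rwa [concatBlocks_mul_add b i hr]⟩
    calc M * i + r < M * (i + 1) := by rw [mul_add_one]; gcongr
      _ ≤ N * M := by rw [mul_comm N]; exact Nat.mul_le_mul_left M hi
  · obtain ⟨r, hr⟩ := chainMap_concatBlocks (N := N) hM b t
    rw [hr, dist_comm]
    exact hbε _ r

theorem exists_seq_isApproxSurjection [CompactSpace X] [ConnectedSpace X]
    [LocallyConnectedSpace X] :
    ∃ F : ℕ → I → X, (∀ k, IsApproxSurjection (1 / 2 / 2 ^ k) (F k)) ∧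
      ∀ k t, dist (F k t) (F (k + 1) t) ≤ 1 / 2 / 2 ^ k := by
  choose δ hδ hδε hmod using fun k : ℕ =>
    exists_isConnectednessModulus (X := X) (ε := 1 / 2 / 2 ^ k) (by positivity)
  let P (k : ℕ) (F : I → X) : Prop := ∃ N c, IsTour Set.univ (δ k) N c ∧ chainMap N c = F
  have hstart : ∃ F, P 0 F := by
    obtain ⟨x⟩ := (inferInstance : Nonempty X)
    obtain ⟨N, c, hc, -⟩ := (eventually_exists_isTour isPreconnected_univ
      isCompact_univ.totallyBounded (hδ 0) (Set.mem_univ x) (Set.mem_univ x)).exists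
    exact ⟨_, N, c, hc, rfl⟩
  have hstep (k : ℕ) (F : {F // P k F}) :
      ∃ G : {G // P (k + 1) G}, ∀ t, dist (F.1 t) (G.1 t) ≤ 1 / 2 / 2 ^ k := by
    obtain ⟨_, N, c, hc, rfl⟩ := F
    obtain ⟨N', c', hc', hdist⟩ := hc.exists_refinement (hmod k) (hδ (k + 1))
    exact ⟨⟨_, N', c', hc', rfl⟩, fun t => (hdist t).le⟩
  choose next hnext using hstep
  let F (k : ℕ) : {F // P k F} := Nat.rec ⟨_, hstart.choose_spec⟩ next k
  have happ (k : ℕ) : IsApproxSurjection (1 / 2 / 2 ^ k) (F k).1 := by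
    obtain ⟨N, c, hc, hF⟩ := (F k).2
    exact hF ▸ hc.isApproxSurjection_chainMap.mono (hδε k)
  exact ⟨fun k => (F k).1, happ, fun k => hnext k (F k)⟩

/-- The **Hahn–Mazurkiewicz theorem**. -/
theorem exists_continuous_surjective_unitInterval (X : Type*) [MetricSpace X] [CompactSpace X]
    [ConnectedSpace X] [LocallyConnectedSpace X] :
    ∃ f : I → X, Continuous f ∧ Function.Surjective f := by
  obtain ⟨F, hF, hdist⟩ := exists_seq_isApproxSurjection (X := X)
  obtain ⟨f, hf⟩ := exists_tendstoUniformly_of_dist_le_geometric_two hdist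
  have hsmall : Tendsto (fun k : ℕ => (1 / 2 / 2 ^ k : ℝ)) atTop (𝓝 0) :=
    tendsto_const_nhds.div_atTop (tendsto_pow_atTop_atTop_of_one_lt one_lt_two)
  have happ : ∀ ε > 0, ∀ᶠ k in atTop, IsApproxSurjection ε (F k) := fun ε hε =>
    (hsmall.eventually_le_const hε).mono fun k hk => (hF k).mono hk
  have hcont := continuous_of_tendstoUniformly_isApproxSurjection hf happ
  refine ⟨f, hcont, Set.range_eq_univ.1 ?_⟩
  rw [← (isCompact_range hcont).isClosed.closure_eq]
  exact (denseRange_of_tendstoUniformly_isApproxSurjection hf happ).closure_range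

end HahnMazurkiewicz

section Parametrization

theorem exists_measurable_rightInverse {T X : Type*} [LinearOrder T] [TopologicalSpace T]
    [OrderTopology T] [SecondCountableTopology T] [MeasurableSpace T] [BorelSpace T]
    [TopologicalSpace X] [T2Space X] [MeasurableSpace X] [OpensMeasurableSpace X]
    {C : Set T} (hC : IsCompact C) {f : T → X} (hf : ContinuousOn f C)
    (hsurj : Set.SurjOn f C Set.univ) :
    ∃ g : X → T, Measurable g ∧ (∀ x, g x ∈ C) ∧ ∀ x, f (g x) = x := by
  have hleast (x : X) : ∃ t, IsLeast (C ∩ f ⁻¹' {x}) t :=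
    (hC.of_isClosed_subset (hf.preimage_isClosed_of_isClosed hC.isClosed isClosed_singleton)
      Set.inter_subset_left).exists_isLeast (hsurj trivial)
  choose g hg using hleast
  have hfg (x : X) : f (g x) = x := (hg x).1.2
  refine ⟨g, measurable_of_Iic fun a => ?_, fun x => (hg x).1.1, hfg⟩
  have himage : g ⁻¹' Set.Iic a = f '' (C ∩ Set.Iic a) := by
    refine Set.Subset.antisymm (fun x hx => ⟨g x, ⟨(hg x).1.1, hx⟩, hfg x⟩) ?_
    rintro _ ⟨t, ⟨htC, hta⟩, rfl⟩
    exact ((hg (f t)).2 ⟨htC, rfl⟩).trans hta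
  rw [himage]
  exact ((hC.inter_right isClosed_Iic).image_of_continuousOn
    (hf.mono Set.inter_subset_left)).isClosed.measurableSet

theorem exists_isClosed_continuousOn_surjOn (X : Type*) [MetricSpace X] [CompactSpace X]
    [Nonempty X] :
    ∃ (C : Set I) (f : I → X), IsClosed C ∧ ContinuousOn f C ∧ Set.SurjOn f C Set.univ := by
  obtain ⟨φ, hφ, hφs⟩ := exists_nat_bool_continuous_surjective_of_compact X
  let C : Set I := Subtype.val ⁻¹' cantorSet
  let ψ (t : C) : X := φ (cantorSetHomeomorphNatToBool ⟨t, t.2⟩)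
  let f : I → X := Function.extend Subtype.val ψ fun _ => Classical.arbitrary X
  have hψ : Continuous ψ := by fun_prop
  have hf (t : C) : f t = ψ t := Subtype.val_injective.extend_apply ψ _ t
  refine ⟨C, f, isClosed_cantorSet.preimage continuous_subtype_val,
    continuousOn_iff_continuous_domRestrict.2 (hψ.congr fun t => (hf t).symm), fun x _ => ?_⟩
  obtain ⟨c, rfl⟩ := (hφs.comp cantorSetHomeomorphNatToBool.surjective) x
  have hc : (⟨c, cantorSet_subset_unitInterval c.2⟩ : I) ∈ C := c.2
  exact ⟨_, hc, hf ⟨_, hc⟩⟩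

theorem exists_parametrization (X : Type*) [TopologicalSpace X] [TopologicalSpace.MetrizableSpace X]
    [CompactSpace X] [Nonempty X] :
    ∃ (C : Set I) (f : I → X), IsClosed C ∧ ContinuousOn f C ∧ Set.SurjOn f C Set.univ ∧
      (ConnectedSpace X → LocallyConnectedSpace X → C = Set.univ) := by
  let _ := TopologicalSpace.metrizableSpaceMetric X
  by_cases hX : ConnectedSpace X ∧ LocallyConnectedSpace X
  · obtain ⟨_, _⟩ := hX
    obtain ⟨f, hf, hsurj⟩ := exists_continuous_surjective_unitInterval X
    exact ⟨Set.univ, f, isClosed_univ, hf.continuousOn, Set.surjOn_univ.2 hsurj, fun _ _ => rfl⟩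
  · obtain ⟨C, f, hC, hf, hsurj⟩ := exists_isClosed_continuousOn_surjOn X
    exact ⟨C, f, hC, hf, hsurj, fun h h' => absurd ⟨h, h'⟩ hX⟩

end Parametrization

section Integration

theorem exists_tendstoUniformly_polynomial (q : C(I, ℝ)) :
    ∃ p : ℕ → ℝ[X],
      TendstoUniformly (fun i (t : I) => (p i).eval (t : ℝ)) (fun t => q t) atTop := by
  have hq : q ∈ closure (polynomialFunctions I : Set C(I, ℝ)) := by
    rw [← Subalgebra.topologicalClosure_coe, polynomialFunctions_closure_eq_top]
    exact trivial
  obtain ⟨r, hr, hrq⟩ := mem_closure_iff_seq_limit.1 hq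
  choose p hp using fun i => (polynomialFunctions_coe I ▸ hr i : r i ∈ Set.range _)
  obtain rfl : (fun i => (p i).toContinuousMapOn I) = r := funext hp
  exact ⟨p, ContinuousMap.tendsto_iff_tendstoUniformly.1 hrq⟩

theorem tendsto_integral_of_tendstoUniformly {Y : Type*} [MeasurableSpace Y] {μ : Measure Y}
    [IsFiniteMeasure μ] {F : ℕ → Y → ℝ} {f : Y → ℝ} (hF : ∀ i, Integrable (F i) μ)
    (hf : Integrable f μ) (h : TendstoUniformly F f atTop) :
    Tendsto (fun i => ∫ y, F i y ∂μ) atTop (𝓝 (∫ y, f y ∂μ)) := by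
  have hbound : ∀ᶠ i in atTop, ∀ y, ‖F i y‖ ≤ ‖f y‖ + 1 := by
    filter_upwards [Metric.tendstoUniformly_iff.1 h 1 one_pos] with i hi y
    have hdist : ‖F i y - f y‖ < 1 := by simpa only [dist_comm, dist_eq_norm] using hi y
    linarith [norm_sub_norm_le (F i y) (f y)]
  exact tendsto_integral_filter_of_dominated_convergence (fun y => ‖f y‖ + 1)
    (.of_forall fun i => (hF i).aestronglyMeasurable) (hbound.mono fun i hi => .of_forall hi)
    (hf.norm.add (integrable_const 1)) (.of_forall fun y => h.tendsto_at y)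

theorem integrable_continuousMap {Y : Type*} [TopologicalSpace Y] [CompactSpace Y]
    [MeasurableSpace Y] [OpensMeasurableSpace Y] (μ : Measure Y) [IsFiniteMeasure μ] (q : C(Y, ℝ)) :
    Integrable q μ :=
  q.continuous.integrable_of_hasCompactSupport (.of_compactSpace _)

theorem HausdorffRepresents.isFiniteMeasure {μ : Measure I} {T : ℝ[X] →ₗ[ℝ] ℝ}
    (h : HausdorffRepresents μ T) : IsFiniteMeasure μ :=
  (integrable_const_iff_isFiniteMeasure one_ne_zero).1
    (by simpa only [Polynomial.eval_one] using (h 1).1)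

end Integration

section Extensions

variable {X : Type*} {V : Submodule ℝ (X → ℝ)} {g : X → I} {L : V →ₗ[ℝ] ℝ}
  {Lbar : ↥(V ⊔ polySpace g) →ₗ[ℝ] ℝ} {μt : Measure I}

theorem Represents.isFiniteMeasure [MeasurableSpace X] {μ : Measure X} (h : Represents μ L)
    (hV : (1 : X → ℝ) ∈ V) : IsFiniteMeasure μ :=
  (integrable_const_iff_isFiniteMeasure (one_ne_zero (α := ℝ))).1 (h ⟨1, hV⟩).1

theorem exists_linearMap_eq_integral [MeasurableSpace X] {μ : Measure X}
    {W : Submodule ℝ (X → ℝ)} (hW : ∀ w ∈ W, Integrable w μ) :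
    ∃ Λ : W →ₗ[ℝ] ℝ, ∀ w : W, Λ w = ∫ x, (w : X → ℝ) x ∂μ :=
  ⟨{ toFun w := ∫ x, (w : X → ℝ) x ∂μ
     map_add' w w' := integral_add (hW w w.2) (hW w' w'.2)
     map_smul' a _ := integral_const_mul a _ }, fun _ => rfl⟩

theorem Represents.exists_isContinuousExtension [MeasurableSpace X] {μ : Measure X}
    (hV : (1 : X → ℝ) ∈ V) (hg : Measurable g) (hμ : Represents μ L) :
    ∃ Lbar : ↥(V ⊔ polySpace g) →ₗ[ℝ] ℝ,
      IsContinuousExtension g L Lbar ∧ HausdorffRepresents (μ.map g) (pullback Lbar) := by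
  have := hμ.isFiniteMeasure hV
  have hcomp (q : C(I, ℝ)) : Integrable (fun x => q (g x)) μ :=
    (integrable_continuousMap (μ.map g) q).comp_measurable hg
  let P (p : ℝ[X]) : C(I, ℝ) := p.toContinuousMapOn I
  have hint : ∀ w ∈ V ⊔ polySpace g, Integrable w μ := by
    intro w hw
    obtain ⟨v, hv, _, ⟨p, rfl⟩, rfl⟩ := Submodule.mem_sup.1 hw
    exact (hμ ⟨v, hv⟩).1.add (hcomp (P p))
  obtain ⟨Lbar, hLbar⟩ := exists_linearMap_eq_integral hint
  refine ⟨Lbar, ⟨fun v => (hLbar _).trans (hμ v).2.symm, fun p q hq hpq => ?_⟩, fun p => ?_⟩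
  · rw [(hμ ⟨_, hq⟩).2]
    simp only [hLbar]
    exact tendsto_integral_of_tendstoUniformly (fun i => hcomp (P (p i))) (hcomp q) (hpq.comp g)
  · refine ⟨integrable_continuousMap _ (P p), (hLbar _).trans ?_⟩
    exact (integral_map hg.aemeasurable (P p).continuous.aestronglyMeasurable).symm

theorem IsContinuousExtension.apply_eq_integral (hL : IsContinuousExtension g L Lbar)
    (hμt : HausdorffRepresents μt (pullback Lbar)) (q : C(I, ℝ))
    (hq : (fun x => q (g x)) ∈ V) : L ⟨fun x => q (g x), hq⟩ = ∫ t, q t ∂μt := by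
  have := hμt.isFiniteMeasure
  obtain ⟨p, hp⟩ := exists_tendstoUniformly_polynomial q
  refine tendsto_nhds_unique (hL.tendsto p q hq hp) ?_
  refine (tendsto_integral_of_tendstoUniformly (fun i => (hμt (p i)).1)
    (integrable_continuousMap μt q) hp).congr fun i => ?_
  exact ((hμt (p i)).2).symm

theorem IsContinuousExtension.ae_mem (hL : IsContinuousExtension g L Lbar)
    (hμt : HausdorffRepresents μt (pullback Lbar)) {C : Set I} (hC : IsClosed C)
    (hg : ∀ x, g x ∈ C) : ∀ᵐ t ∂μt, t ∈ C := by
  have := hμt.isFiniteMeasure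
  obtain ⟨q, rfl, hq⟩ :=
    perfectlyNormalSpace_iff_forall_isClosed_preimage_zero.1 inferInstance C hC
  have hqg : (fun x => q (g x)) = 0 := funext hg
  have hint : ∫ t, q t ∂μt = 0 := by
    rw [← hL.apply_eq_integral hμt q (hqg ▸ V.zero_mem), ← map_zero L]
    exact congrArg L (Subtype.ext hqg)
  exact (integral_eq_zero_iff_of_nonneg (fun t => (hq t).1) (integrable_continuousMap μt q)).1 hint

theorem IsContinuousExtension.represents_map [TopologicalSpace X] [MeasurableSpace X]
    [BorelSpace X] (hL : IsContinuousExtension g L Lbar) (hV : ∀ v ∈ V, Continuous v)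
    (hμt : HausdorffRepresents μt (pullback Lbar)) {C : Set I} (hC : IsClosed C) {f : I → X}
    (hf : ContinuousOn f C) (hg : ∀ x, g x ∈ C) (hfg : ∀ x, f (g x) = x) :
    Represents (μt.map f) L := by
  have := hμt.isFiniteMeasure
  have hmem : ∀ᵐ t ∂μt, t ∈ C := hL.ae_mem hμt hC hg
  have hfm : AEMeasurable f μt := by
    simpa only [Measure.restrict_eq_self_of_ae_mem hmem] using
      hf.aemeasurable (μ := μt) hC.measurableSet
  rintro ⟨v, hv⟩
  have hvm : AEStronglyMeasurable v (μt.map f) := (hV v hv).measurable.aestronglyMeasurable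
  obtain ⟨q, hq⟩ := ContinuousMap.exists_restrict_eq hC
    ⟨C.domRestrict (v ∘ f), ((hV v hv).comp_continuousOn hf).domRestrict⟩
  have hqf (t : I) (ht : t ∈ C) : q t = v (f t) := DFunLike.congr_fun hq ⟨t, ht⟩
  have hqg : (fun x => q (g x)) = v := funext fun x => by rw [hqf _ (hg x), hfg]
  have hae : q =ᵐ[μt] v ∘ f := hmem.mono hqf
  refine ⟨(integrable_map_measure hvm hfm).2 ((integrable_continuousMap μt q).congr hae), ?_⟩
  calc L ⟨v, hv⟩ = L ⟨fun x => q (g x), hqg ▸ hv⟩ := congrArg L (Subtype.ext hqg.symm)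
    _ = ∫ t, q t ∂μt := hL.apply_eq_integral hμt q _
    _ = ∫ t, v (f t) ∂μt := integral_congr_ae hae
    _ = ∫ x, v x ∂(μt.map f) := (integral_map hfm hvm).symm

end Extensions

end MomentTransform

theorem theorem4p2_general (X : Type*) [TopologicalSpace X] [TopologicalSpace.MetrizableSpace X]
    [CompactSpace X] [Nonempty X] [MeasurableSpace X] [BorelSpace X] :
    ∃ g : X → I, Measurable g ∧
      (∀ (V : Submodule ℝ (X → ℝ)), (1 : X → ℝ) ∈ V → (∀ v ∈ V, Continuous v) →
        ∀ L : V →ₗ[ℝ] ℝ,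
          (MomentTransform.IsMomentFunctional L ↔
            ∃ Lbar : ↥(V ⊔ MomentTransform.polySpace g) →ₗ[ℝ] ℝ,
              MomentTransform.IsContinuousExtension g L Lbar ∧
              MomentTransform.IsHausdorffMomentFunctional (MomentTransform.pullback Lbar)) ∧
          (∀ μ : Measure X, MomentTransform.Represents μ L →
            ∃ Lbar : ↥(V ⊔ MomentTransform.polySpace g) →ₗ[ℝ] ℝ,
              MomentTransform.IsContinuousExtension g L Lbar ∧
              MomentTransform.HausdorffRepresents (μ.map g) (MomentTransform.pullback Lbar))) ∧
      (ConnectedSpace X → LocallyConnectedSpace X →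
        ∃ f : I → X, Continuous f ∧ Function.Surjective f ∧ (∀ x, f (g x) = x) ∧
          ∀ (V : Submodule ℝ (X → ℝ)), (∀ v ∈ V, Continuous v) →
            ∀ (L : V →ₗ[ℝ] ℝ) (Lbar : ↥(V ⊔ MomentTransform.polySpace g) →ₗ[ℝ] ℝ),
              MomentTransform.IsContinuousExtension g L Lbar →
              ∀ μt : Measure I,
                MomentTransform.HausdorffRepresents μt (MomentTransform.pullback Lbar) →
                MomentTransform.Represents (μt.map f) L) := by
  obtain ⟨C, f, hC, hf, hsurj, hCuniv⟩ := MomentTransform.exists_parametrization X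
  obtain ⟨g, hg, hgC, hfg⟩ := MomentTransform.exists_measurable_rightInverse hC.isCompact hf hsurj
  refine ⟨g, hg, fun V h1 hV L => ⟨⟨?_, ?_⟩, fun μ hμ => hμ.exists_isContinuousExtension h1 hg⟩,
    fun hX hX' => ?_⟩
  · rintro ⟨μ, hμ⟩
    obtain ⟨Lbar, hLbar, hrep⟩ := hμ.exists_isContinuousExtension h1 hg
    exact ⟨Lbar, hLbar, _, hrep⟩
  · rintro ⟨Lbar, hLbar, μt, hμt⟩
    exact ⟨_, hLbar.represents_map hV hμt hC hf hgC hfg⟩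
  · obtain rfl := hCuniv hX hX'
    exact ⟨f, continuousOn_univ.1 hf, fun x => ⟨g x, hfg x⟩, hfg,
      fun V hV L Lbar hLbar μt hμt => hLbar.represents_map hV hμt hC hf hgC hfg⟩

theorem theorem4p2 (n : ℕ) (K : Set (EuclideanSpace ℝ (Fin n)))
    (hK : IsCompact K) (hpath : IsPathConnected K) :
    ∃ g : K → unitInterval, Measurable g ∧
      -- the equivalence, for all spaces `V` with `1 ∈ V ⊆ C(K, ℝ)` and all linear `L : V → ℝ`
      (∀ (V : Submodule ℝ (K → ℝ)), (1 : K → ℝ) ∈ V → (∀ v ∈ V, Continuous v) →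
        ∀ L : V →ₗ[ℝ] ℝ,
          (MomentTransform.IsMomentFunctional L ↔
            ∃ Lbar : ↥(V ⊔ MomentTransform.polySpace g) →ₗ[ℝ] ℝ,
              MomentTransform.IsContinuousExtension g L Lbar ∧
              MomentTransform.IsHausdorffMomentFunctional (MomentTransform.pullback Lbar)) ∧
          -- each representing measure `μ` of `L` yields an extension represented by `μ ∘ g⁻¹`
          (∀ μ : MeasureTheory.Measure K, MomentTransform.Represents μ L →
            ∃ Lbar : ↥(V ⊔ MomentTransform.polySpace g) →ₗ[ℝ] ℝ,
              MomentTransform.IsContinuousExtension g L Lbar ∧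
              MomentTransform.HausdorffRepresents (μ.map g)
                (MomentTransform.pullback Lbar))) ∧
      -- if `K` is locally connected, `g` is a section of a fixed continuous surjection `f`
      (LocallyConnectedSpace K →
        ∃ f : unitInterval → K, Continuous f ∧ Function.Surjective f ∧ (∀ x, f (g x) = x) ∧
          ∀ (V : Submodule ℝ (K → ℝ)), (1 : K → ℝ) ∈ V → (∀ v ∈ V, Continuous v) →
            ∀ (L : V →ₗ[ℝ] ℝ) (Lbar : ↥(V ⊔ MomentTransform.polySpace g) →ₗ[ℝ] ℝ),
              MomentTransform.IsContinuousExtension g L Lbar →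
              ∀ μt : MeasureTheory.Measure unitInterval,
                MomentTransform.HausdorffRepresents μt (MomentTransform.pullback Lbar) →
                MomentTransform.Represents (μt.map f) L) := by
  have : CompactSpace K := isCompact_iff_compactSpace.1 hK
  have : ConnectedSpace K := isConnected_iff_connectedSpace.1 hpath.isConnected
  obtain ⟨g, hg, ha, hb⟩ := theorem4p2_general K
  refine ⟨g, hg, ha, fun hloc => ?_⟩
  obtain ⟨f, hf, hsurj, hfg, hrep⟩ := hb inferInstance hloc
  exact ⟨f, hf, hsurj, hfg, fun V _ => hrep V⟩
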